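/- Let $Y\subset[0,\infty)$ be compact with $0\in Y$. An action is a pair $a=(F,c)$ of a Borel probability distribution $F$ on $Y$ and a cost $c\ge 0$; a technology is a set of actions. A contract is a measurable function $w:Y\to[0,\infty)$; under it the agent's utility from $(F,c)$ is $\mathbb E_F[w(y)]-c$ and the principal's payoff is $\mathbb E_F[y-w(y)]$ (possibly $-\infty$). A randomized contract is a random contract $w\sim G$ (jointly measurable in the randomness and in $y$). The principal commits to $G$ knowing only a technology $\mathcal A_0$; the adversary then picks a technology $\mathcal A\supseteq\mathcal A_0$ in which the agent has a utility-maximizing action for $G$-almost every $w$; then $w$ is realized and the agent takes a utility-maximizing action from $\mathcal A$. The guarantee of $G$ is the infimum over such $\mathcal A$ of the principal's expected payoff, where ties of the agent are broken in favour of the principal (best-case) or against him (worst-case). Assume that $\mathcal A_0$ is finite, contains the null action $(\delta_0,0)$ and an action $(F_0,c_0)$ with $\mathbb E_{F_0}[y]-c_0>0$. Let $\underline u(\alpha)=\max_{(F,c)\in\mathcal A_0}(\alpha\,\mathbb E_F[y]-c)$ and let $$\rho(\alpha)=\frac{\underline u(\alpha)}{-\ln(1-\alpha)}\quad(0<\alpha<1),\qquad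 \rho(0)=\lim_{\alpha\to0^+}\rho(\alpha),\qquad \rho(1)=0 .$$ The limit exists and $\rho$ attains its maximum on $[0,1]$. Let $\alpha^*\in[0,1]$ be any maximizer and $V=\rho(\alpha^*)$. Then $\alpha^*<1$, $V>0$, and the following hold. 1. The maximum over all randomized contracts of the guarantee under best-case tie-breaking equals $V$. If $\alpha^*>0$, the maximum of the guarantee under worst-case tie-breaking also equals $V$. 2. These maxima are attained by the linear contract $w_\alpha(y)=\alpha y$ with random slope $\alpha$ distributed on $[0,\alpha^*]$ with distribution function $G^*(\alpha)=\ln(1-\alpha)/\ln(1-\alpha^*)$ (the slope is $0$ with probability one if $\alpha^*=0$). 3. If $\alpha^*=0$, then $V=\max\big\{(\sqrt{\mathbb E_F[y]}-\sqrt c)^2 : (F,c)\in\mathcal A_0,\ c\le\mathbb E_F[y]\big\}$. 4. Let $e^*(\alpha)=V/(1-\alpha)$, $c^*(\alpha)=\alpha e^*(\alpha)-\int_0^\alpha e^*(t)\,dt$ and $M=\max_{(F,c)\in\mathcal A_0}\mathbb E_F[y]$. Let $\mathcal A^*$ consist of all actions with $\mathbb E_F[y]\le e^*(0)$, and of all actions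 $(F,c)$ for which some $\alpha\in(0,1)$ satisfies $e^*(\alpha)\le M$, $\mathbb E_F[y]=e^*(\alpha)$ and $c\ge c^*(\alpha)$. Then $\mathcal A^*\supseteq\mathcal A_0$; every continuous contract has a utility-maximizing action in $\mathcal A^*$; and, against $\mathcal A^*$, no contract, deterministic or randomized, gives the principal an (expected) payoff above $V$, even under best-case tie-breaking. Moreover there is a technology $\mathcal A$ with $\mathcal A_0\subseteq\mathcal A\subseteq\mathcal A^*$, not depending on the contract, in which the agent has a utility-maximizing response to every randomized contract, and against which every randomized contract gives an expected payoff of at most $V$, even under best-case tie-breaking. -/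

import Mathlib

open MeasureTheory Filter Topology Set
open scoped ENNReal NNReal

noncomputable section

namespace RobustContract

/-- An action `(F, c)`: a distribution `F` of the output on `Y` and a nonnegative cost `c`.
A technology is a set of actions. -/
abbrev Action (Y : Set ℝ) : Type := ProbabilityMeasure Y × ℝ≥0

variable {Y : Set ℝ}

/-- The null action `(δ₀, 0)`. -/
def nullAction (h0 : (0 : ℝ) ∈ Y) : Action Y :=
  (⟨Measure.dirac (⟨0, h0⟩ : Y), inferInstance⟩, 0)

/-- The expected output `E_F[y]` of an action (`Y` is bounded wherever this is used). -/
def meanOutput (a : Action Y) : ℝ := ∫ y : Y, (y : ℝ) ∂(a.1 : Measure Y)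

/-- The expected wage `E_F[w(y)]` of a contract `w : Y → ℝ₊` under an action; it may be `∞`. -/
def expectedWage (w : Y → ℝ≥0) (a : Action Y) : ℝ≥0∞ :=
  ∫⁻ y : Y, (w y : ℝ≥0∞) ∂(a.1 : Measure Y)

/-- The agent's utility `E_F[w(y)] - c`. -/
def agentUtility (w : Y → ℝ≥0) (a : Action Y) : EReal :=
  (expectedWage w a : EReal) - ((a.2 : ℝ) : EReal)

/-- The principal's payoff `E_F[y - w(y)] = E_F[y] - E_F[w(y)]`. -/
def principalPayoff (w : Y → ℝ≥0) (a : Action Y) : EReal :=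
  ((meanOutput a : ℝ) : EReal) - (expectedWage w a : EReal)

/-- The utility-maximizing actions of the agent in the technology `A` under the contract `w`. -/
def optimalActions (A : Set (Action Y)) (w : Y → ℝ≥0) : Set (Action Y) :=
  {a | a ∈ A ∧ ∀ b ∈ A, agentUtility w b ≤ agentUtility w a}

/-- A randomized contract: a random (jointly measurable) wage function `Y → ℝ₊`. -/
structure RandomContract (Y : Set ℝ) where
  /-- the sample space -/
  Ω : Type
  /-- its events -/
  mΩ : MeasurableSpace Ω
  /-- the probability measure -/
  P : Measure Ω
  /-- it has total mass one -/
  isProb : IsProbabilityMeasure P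
  /-- the realized wage function -/
  wage : Ω → Y → ℝ≥0
  /-- joint measurability -/
  measurable_wage : Measurable (Function.uncurry wage)

attribute [instance] RandomContract.mΩ RandomContract.isProb

/-- The agent's possible behaviours: to (almost) every realized contract she responds with a
utility-maximizing action of the technology `A`. -/
def responses (A : Set (Action Y)) (R : RandomContract Y) : Set (R.Ω → Action Y) :=
  {a | ∀ᵐ ω ∂(R.P), a ω ∈ optimalActions A (R.wage ω)}

/-- The principal's expected payoff (expected output minus expected wage) when the agent behaves
according to `a`. The expected output is finite, since outputs lie in a bounded subset of `ℝ₊`. -/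
def expectedPayoff (R : RandomContract Y) (a : R.Ω → Action Y) : EReal :=
  ((∫⁻ ω, ENNReal.ofReal (meanOutput (a ω)) ∂(R.P) : ℝ≥0∞) : EReal)
    - ((∫⁻ ω, expectedWage (R.wage ω) (a ω) ∂(R.P) : ℝ≥0∞) : EReal)

/-- Expected payoff under the technology `A`, ties broken in favour of the principal. -/
def bestPayoff (A : Set (Action Y)) (R : RandomContract Y) : EReal :=
  ⨆ a ∈ responses A R, expectedPayoff R a

/-- Expected payoff under the technology `A`, ties broken against the principal. -/
def worstPayoff (A : Set (Action Y)) (R : RandomContract Y) : EReal :=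
  ⨅ a ∈ responses A R, expectedPayoff R a

/-- The technologies the adversary may choose against `R`: supersets of the known technology in
which the agent does have a utility-maximizing response. -/
def admissible (A₀ : Set (Action Y)) (R : RandomContract Y) : Set (Set (Action Y)) :=
  {A | A₀ ⊆ A ∧ (responses A R).Nonempty}

/-- The payoff that `R` guarantees under best-case tie-breaking. -/
def bestGuarantee (A₀ : Set (Action Y)) (R : RandomContract Y) : EReal :=
  ⨅ A ∈ admissible A₀ R, bestPayoff A R

/-- The payoff that `R` guarantees under worst-case tie-breaking. -/
def worstGuarantee (A₀ : Set (Action Y)) (R : RandomContract Y) : EReal :=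
  ⨅ A ∈ admissible A₀ R, worstPayoff A R

/-- The linear contract `w_α(y) = α y` (slopes are in `[0, 1]` and outputs are nonnegative, so
that the truncation at `0` is never active). -/
def linearContract (α : ℝ) (y : Y) : ℝ≥0 := (α * (y : ℝ)).toNNReal

/-- The linear contract with a random slope drawn from `G`. -/
def randomLinear (Y : Set ℝ) (G : ProbabilityMeasure ℝ) : RandomContract Y where
  Ω := ℝ
  mΩ := inferInstance
  P := G
  isProb := inferInstance
  wage := fun α => linearContract α
  measurable_wage := by
    unfold Function.uncurry linearContract
    fun_prop

/-- `u̲(α) = max_{(F, c) ∈ A₀} (α E_F[y] - c)`, for a finite nonempty `A₀`. -/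
def uLow (A₀ : Set (Action Y)) (α : ℝ) : ℝ :=
  sSup ((fun a : Action Y => α * meanOutput a - (a.2 : ℝ)) '' A₀)

/-- The ratio `u̲(α) / (-ln (1 - α))` on `[0, 1]`; at `α = 0` it is the limit `α → 0⁺`, and at
`α = 1`, where the denominator is `+∞`, it is `0`. -/
def ratio (A₀ : Set (Action Y)) (α : ℝ) : ℝ :=
  if α = 0 then limUnder (𝓝[>] (0 : ℝ)) (fun β => uLow A₀ β / (-Real.log (1 - β)))
  else if α = 1 then 0
  else uLow A₀ α / (-Real.log (1 - α))

/-- The distribution function `G*` on the whole line; it is `ln (1 - α) / ln (1 - α*)` on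
`[0, α*]`, and the unit step at `0` if `α* = 0`. -/
def gStar (αs α : ℝ) : ℝ :=
  if α < 0 then 0
  else if αs ≤ α then 1
  else Real.log (1 - α) / Real.log (1 - αs)

/-- `e*(α) = V / (1 - α)`. -/
def eStar (V α : ℝ) : ℝ := V / (1 - α)

/-- `c*(α) = α e*(α) - ∫₀^α e*(t) dt`. -/
def cStar (V α : ℝ) : ℝ := α * eStar V α - ∫ t in (0 : ℝ)..α, eStar V t

/-- The largest expected output in the known technology. -/
def maxMean (A₀ : Set (Action Y)) : ℝ := sSup (meanOutput '' A₀)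

/-- The adversary's technology: all actions with `E_F[y] ≤ e*(0)`, and all actions with
`E_F[y] = e*(α)` and cost at least `c*(α)` for some `α > 0` with `e*(α)` at most the largest
expected output in the known technology. -/
def worstTechnology (A₀ : Set (Action Y)) (V : ℝ) : Set (Action Y) :=
  {a | meanOutput a ≤ eStar V 0} ∪
  {a | ∃ α ∈ Ioo (0 : ℝ) 1, eStar V α ≤ maxMean A₀ ∧
    meanOutput a = eStar V α ∧ cStar V α ≤ (a.2 : ℝ)}

end RobustContract

end

open RobustContract

/-! Lower bound. For a technology `A`, the agent's maximal utility `u(α) = uLow A α` under slope `α`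
is a supremum of affine functions with bounded slopes. It is therefore Lipschitz, and wherever it is
differentiable every optimal action has mean output `u'(α)`. A random slope gives the principal `∫
(1 - α) u'(α) dG(α)`. The density of `G*` is proportional to `1 / (1 - α)`, so the integral
telescopes to `u(α*) / (-ln (1 - α*))` however ties are broken, and enlarging the known technology
only raises `u` (`expectedPayoff_slopeDistribution`). If `α* = 0`, the zero contract with the best
costless known action takes over.

Upper bound. Let mean output `e` cost at least `φ(e) = e - V - V ln (e / V)` for `e ≥ V`, and
nothing below `V` (`costFloor`). An agent whose optimal action has mean `e > V` and expected wage
`W` may mix in the null output with weight `s`: she loses at most `s W` and saves at least `s e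
φ'(e) = s (e - V)` to first order. Hence `W ≥ e - V` under every contract
(`meanOutput_le_add_expectedWage`). Maximality of the ratio says that the known actions respect this
floor (`costFloor_le_cost`). The argument only uses dilutions, so the known actions and their
dilutions already form a bad technology; there an optimum exists for every contract, continuous or
not. -/

noncomputable section

namespace RobustContract

/-! ### Expected output, wages and utilities -/

section Basics

variable {Y : Set ℝ}

lemma exists_output_bound (hYc : IsCompact Y) : ∃ B : ℝ≥0, ∀ y : Y, |(y : ℝ)| ≤ B := by
  obtain ⟨C, hC⟩ := hYc.isBounded.exists_norm_le
  exact ⟨C.toNNReal, fun y => (hC y y.2).trans (Real.le_coe_toNNReal C)⟩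

lemma integrable_output (hYc : IsCompact Y) (F : ProbabilityMeasure Y) :
    Integrable (fun y : Y => (y : ℝ)) (F : Measure Y) := by
  obtain ⟨B, hB⟩ := exists_output_bound hYc
  exact Integrable.of_bound measurable_subtype_coe.aestronglyMeasurable (B : ℝ)
    (ae_of_all _ hB)

lemma abs_meanOutput_le {B : ℝ≥0} (hB : ∀ y : Y, |(y : ℝ)| ≤ B) (a : Action Y) :
    |meanOutput a| ≤ B := by
  have := norm_integral_le_of_norm_le_const (μ := (a.1 : Measure Y))
    (f := fun y : Y => (y : ℝ)) (C := (B : ℝ)) (ae_of_all _ hB)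
  simpa [meanOutput] using this

lemma meanOutput_nonneg (hYpos : ∀ y ∈ Y, 0 ≤ y) (a : Action Y) : 0 ≤ meanOutput a :=
  integral_nonneg fun y => hYpos y y.2

lemma meanOutput_nullAction (h0 : (0 : ℝ) ∈ Y) : meanOutput (nullAction h0) = 0 := by
  simp [meanOutput, nullAction]

lemma expectedWage_linearContract (hYc : IsCompact Y) (hYpos : ∀ y ∈ Y, 0 ≤ y) {α : ℝ}
    (hα : 0 ≤ α) (a : Action Y) :
    expectedWage (linearContract α) a = ENNReal.ofReal (α * meanOutput a) := by
  unfold expectedWage linearContract meanOutput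
  rw [← integral_const_mul, ofReal_integral_eq_lintegral_ofReal
    ((integrable_output hYc a.1).const_mul α) (ae_of_all _ fun y => mul_nonneg hα (hYpos y y.2))]
  rfl

lemma agentUtility_of_ne_top {w : Y → ℝ≥0} {a : Action Y} (h : expectedWage w a ≠ ∞) :
    agentUtility w a = (((expectedWage w a).toReal - (a.2 : ℝ) : ℝ) : EReal) := by
  unfold agentUtility
  rw [EReal.coe_sub, ← EReal.coe_ennreal_toReal h]

lemma agentUtility_of_eq_top {w : Y → ℝ≥0} {a : Action Y} (h : expectedWage w a = ∞) :
    agentUtility w a = ⊤ := by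
  unfold agentUtility
  rw [h, EReal.coe_ennreal_top, EReal.top_sub_coe]

lemma agentUtility_linearContract (hYc : IsCompact Y) (hYpos : ∀ y ∈ Y, 0 ≤ y) {α : ℝ}
    (hα : 0 ≤ α) (a : Action Y) :
    agentUtility (linearContract α) a = ((α * meanOutput a - (a.2 : ℝ) : ℝ) : EReal) := by
  have h := expectedWage_linearContract hYc hYpos hα a
  rw [agentUtility_of_ne_top (by rw [h]; exact ENNReal.ofReal_ne_top), h,
    ENNReal.toReal_ofReal (mul_nonneg hα (meanOutput_nonneg hYpos a))]

end Basics

/-! ### The agent's value function over linear contracts -/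

section Envelope

variable {Y : Set ℝ} {A : Set (Action Y)}

lemma bddAbove_utilities (hYc : IsCompact Y) (A : Set (Action Y)) (α : ℝ) :
    BddAbove ((fun a : Action Y => α * meanOutput a - (a.2 : ℝ)) '' A) := by
  obtain ⟨B, hB⟩ := exists_output_bound hYc
  refine ⟨|α| * B, ?_⟩
  rintro _ ⟨a, -, rfl⟩
  have h1 : α * meanOutput a ≤ |α| * B := by
    refine (le_abs_self _).trans ?_
    rw [abs_mul]
    exact mul_le_mul_of_nonneg_left (abs_meanOutput_le hB a) (abs_nonneg α)
  have h2 : (0 : ℝ) ≤ a.2 := a.2.2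
  simp only
  linarith

lemma le_uLow (hYc : IsCompact Y) {a : Action Y} (ha : a ∈ A) (α : ℝ) :
    α * meanOutput a - (a.2 : ℝ) ≤ uLow A α :=
  le_csSup (bddAbove_utilities hYc A α) ⟨a, ha, rfl⟩

lemma uLow_le (hA : A.Nonempty) {α C : ℝ} (h : ∀ a ∈ A, α * meanOutput a - (a.2 : ℝ) ≤ C) :
    uLow A α ≤ C :=
  csSup_le (hA.image _) (by rintro _ ⟨a, ha, rfl⟩; exact h a ha)

lemma uLow_mono_set (hYc : IsCompact Y) {A₀ : Set (Action Y)} (h₀ : A₀.Nonempty) (h : A₀ ⊆ A)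
    (α : ℝ) : uLow A₀ α ≤ uLow A α :=
  uLow_le h₀ fun _ ha => le_uLow hYc (h ha) α

lemma uLow_nonneg (hYc : IsCompact Y) (h0 : (0 : ℝ) ∈ Y) (hnull : nullAction h0 ∈ A) (α : ℝ) :
    0 ≤ uLow A α := by
  have := le_uLow hYc hnull α
  rw [meanOutput_nullAction] at this
  simpa [nullAction] using this

lemma uLow_zero (hYc : IsCompact Y) (h0 : (0 : ℝ) ∈ Y) (hnull : nullAction h0 ∈ A) :
    uLow A 0 = 0 :=
  le_antisymm (uLow_le ⟨_, hnull⟩ fun a _ => by simp) (uLow_nonneg hYc h0 hnull 0)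

/-- A supremum of affine functions with slopes bounded by `B`. This supplies both almost everywhere
differentiability and absolute continuity, for technologies of any size. -/
lemma lipschitzWith_uLow (hA : A.Nonempty) (hYc : IsCompact Y) {B : ℝ≥0}
    (hB : ∀ y : Y, |(y : ℝ)| ≤ B) : LipschitzWith B (uLow A) := by
  refine LipschitzWith.of_le_add_mul B fun x y => uLow_le hA fun a ha => ?_
  have h1 := le_uLow hYc ha y
  have h2 : (x - y) * meanOutput a ≤ B * dist x y := by
    refine (le_abs_self _).trans ?_
    rw [abs_mul, mul_comm, Real.dist_eq]
    exact mul_le_mul_of_nonneg_right (abs_meanOutput_le hB a) (abs_nonneg _)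
  linarith

lemma continuous_uLow (hA : A.Nonempty) (hYc : IsCompact Y) : Continuous (uLow A) := by
  obtain ⟨B, hB⟩ := exists_output_bound hYc
  exact (lipschitzWith_uLow hA hYc hB).continuous

lemma uLow_eq_of_optimal (hYc : IsCompact Y) (hYpos : ∀ y ∈ Y, 0 ≤ y) {α : ℝ} (hα : 0 ≤ α)
    {a : Action Y} (ha : a ∈ optimalActions A (linearContract α)) :
    uLow A α = α * meanOutput a - (a.2 : ℝ) := by
  refine le_antisymm (uLow_le ⟨a, ha.1⟩ fun b hb => ?_) (le_uLow hYc ha.1 α)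
  have := ha.2 b hb
  rwa [agentUtility_linearContract hYc hYpos hα, agentUtility_linearContract hYc hYpos hα,
    EReal.coe_le_coe_iff] at this

/-- The envelope theorem for linear contracts. -/
lemma deriv_uLow_eq_meanOutput (hYc : IsCompact Y) (hYpos : ∀ y ∈ Y, 0 ≤ y) {α : ℝ} (hα : 0 ≤ α)
    {a : Action Y} (ha : a ∈ optimalActions A (linearContract α))
    (hd : DifferentiableAt ℝ (uLow A) α) : deriv (uLow A) α = meanOutput a := by
  -- The utility line of `a` supports `uLow A` from below and touches it at `α`.
  have hmin : IsLocalMin (fun β => uLow A β - β * meanOutput a) α := by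
    refine Eventually.of_forall fun β => ?_
    have h1 := le_uLow hYc ha.1 β
    have h2 := uLow_eq_of_optimal hYc hYpos hα ha
    simp only
    linarith
  have h := (hd.hasDerivAt.sub ((hasDerivAt_id α).mul_const (meanOutput a))).deriv
  have h' := hmin.deriv_eq_zero
  have : deriv (uLow A) α - 1 * meanOutput a = 0 := by rw [← h]; exact h'
  linarith

end Envelope

/-! ### The cost floor of the adversary's technology -/

section CostFloor

/-- The least cost of an action with expected output `e` in the adversary's technology. -/
def costFloor (V e : ℝ) : ℝ := max e V - V - V * Real.log (max e V / V)

lemma costFloor_of_le {V e : ℝ} (hV : 0 < V) (h : e ≤ V) : costFloor V e = 0 := by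
  simp [costFloor, max_eq_right h, div_self hV.ne']

lemma costFloor_of_ge {V e : ℝ} (h : V ≤ e) : costFloor V e = e - V - V * Real.log (e / V) := by
  simp [costFloor, max_eq_left h]

lemma costFloor_nonneg {V : ℝ} (hV : 0 < V) (e : ℝ) : 0 ≤ costFloor V e := by
  have hm : V ≤ max e V := le_max_right _ _
  have h := Real.log_le_sub_one_of_pos (div_pos (hV.trans_le hm) hV)
  have h2 := mul_le_mul_of_nonneg_left h hV.le
  have h3 : V * (max e V / V - 1) = max e V - V := by field_simp
  unfold costFloor
  linarith

lemma continuous_costFloor {V : ℝ} (hV : 0 < V) : Continuous (costFloor V) := by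
  unfold costFloor
  refine Continuous.sub (by fun_prop) (continuous_const.mul (Continuous.log (by fun_prop) ?_))
  intro e
  exact (div_pos (hV.trans_le (le_max_right e V)) hV).ne'

lemma integral_eStar {V α : ℝ} (hα : α < 1) (h0 : 0 ≤ α) :
    ∫ t in (0 : ℝ)..α, eStar V t = - V * Real.log (1 - α) := by
  have hd : ∀ t ∈ uIcc 0 α, HasDerivAt (fun t => - V * Real.log (1 - t)) (eStar V t) t := by
    intro t ht
    rw [uIcc_of_le h0] at ht
    have h1 : 1 - t ≠ 0 := by linarith [ht.2]
    have := (((hasDerivAt_id t).const_sub 1).log h1).const_mul (-V)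
    refine this.congr_deriv ?_
    rw [eStar, id]
    ring
  have hc : ContinuousOn (eStar V) (uIcc 0 α) := by
    unfold eStar
    refine ContinuousOn.div (by fun_prop) (by fun_prop) fun t ht => ?_
    rw [uIcc_of_le h0] at ht
    linarith [ht.2]
  rw [intervalIntegral.integral_eq_sub_of_hasDerivAt hd hc.intervalIntegrable]
  simp

/-- Eliminates the parameter from the curve `(e*, c*)`: along it `1 - α = V / e`. -/
lemma cStar_eq_costFloor {V α : ℝ} (hV : 0 < V) (h0 : 0 ≤ α) (h1 : α < 1) :
    cStar V α = costFloor V (eStar V α) := by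
  have h1' : (0 : ℝ) < 1 - α := by linarith
  have hge : V ≤ eStar V α := by
    unfold eStar
    rw [le_div_iff₀ h1']
    nlinarith
  rw [costFloor_of_ge hge, cStar, integral_eStar h1 h0]
  have : eStar V α / V = (1 - α)⁻¹ := by
    unfold eStar
    field_simp
  rw [this, Real.log_inv]
  have h2 : eStar V α * (1 - α) = V := by unfold eStar; field_simp
  linarith

/-- Means above `V` correspond to slopes by `α = 1 - V / e`. The cap is a maximum because means up
to `V = e*(0)` are allowed even when they exceed all known means. -/
lemma mem_worstTechnology_iff {Y : Set ℝ} {A₀ : Set (Action Y)} {V : ℝ} (hV : 0 < V)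
    (a : Action Y) : a ∈ worstTechnology A₀ V ↔
      meanOutput a ≤ max V (maxMean A₀) ∧ costFloor V (meanOutput a) ≤ (a.2 : ℝ) := by
  constructor
  · rintro (h | ⟨α, hα, hM, hm, hc⟩)
    · have h' : meanOutput a ≤ V := by simpa [eStar] using h
      exact ⟨h'.trans (le_max_left _ _), by rw [costFloor_of_le hV h']; exact a.2.2⟩
    · rw [cStar_eq_costFloor hV hα.1.le hα.2] at hc
      rw [hm]
      exact ⟨hM.trans (le_max_right _ _), hc⟩
  · rintro ⟨hm, hc⟩
    rcases le_or_gt (meanOutput a) V with h | h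
    · left
      simpa [eStar] using h
    · right
      have hpos : 0 < meanOutput a := hV.trans h
      have hα : 1 - V / meanOutput a ∈ Ioo (0 : ℝ) 1 :=
        ⟨by rw [sub_pos, div_lt_one hpos]; exact h, by linarith [div_pos hV hpos]⟩
      have he : eStar V (1 - V / meanOutput a) = meanOutput a := by
        unfold eStar
        rw [sub_sub_cancel]
        field_simp
      refine ⟨_, hα, ?_, he.symm, ?_⟩
      · rw [he]
        exact (le_max_iff.1 hm).resolve_left (not_le.2 h)
      · rw [cStar_eq_costFloor hV hα.1.le hα.2, he]
        exact hc

end CostFloor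

/-! ### The upper bound by dilution -/

section UpperBound

variable {Y : Set ℝ}

/-- The mixture `t F + (1 - t) δ₀`. -/
def shrink (h0 : (0 : ℝ) ∈ Y) (t : unitInterval) (F : ProbabilityMeasure Y) :
    ProbabilityMeasure Y :=
  ⟨ENNReal.ofReal t • (F : Measure Y) + ENNReal.ofReal (1 - t) • Measure.dirac (⟨0, h0⟩ : Y), ⟨by
    simp only [Measure.add_apply, Measure.smul_apply, measure_univ, smul_eq_mul, mul_one]
    rw [← ENNReal.ofReal_add t.2.1 (sub_nonneg.2 t.2.2)]
    simp⟩⟩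

/-- The cheapest way to obtain the distribution `F` in the adversary's technology. -/
def floorAction (V : ℝ) (F : ProbabilityMeasure Y) : Action Y :=
  (F, (costFloor V (meanOutput (F, 0))).toNNReal)

lemma floorAction_cost {V : ℝ} (hV : 0 < V) (a : Action Y) :
    ((floorAction V a.1).2 : ℝ) = costFloor V (meanOutput a) :=
  Real.coe_toNNReal _ (costFloor_nonneg hV _)

lemma expectedWage_floorAction (V : ℝ) (w : Y → ℝ≥0) (a : Action Y) :
    expectedWage w (floorAction V a.1) = expectedWage w a := rfl

lemma meanOutput_shrink (hYc : IsCompact Y) (h0 : (0 : ℝ) ∈ Y) (t : unitInterval)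
    (F : ProbabilityMeasure Y) (c : ℝ≥0) :
    meanOutput (shrink h0 t F, c) = t * meanOutput (F, c) := by
  have hF := (integrable_output hYc F).smul_measure (ENNReal.ofReal_ne_top (r := (t : ℝ)))
  have hd : Integrable (fun y : Y => (y : ℝ))
      (ENNReal.ofReal (1 - t) • Measure.dirac (⟨0, h0⟩ : Y)) :=
    (integrable_output hYc ⟨Measure.dirac (⟨0, h0⟩ : Y), inferInstance⟩).smul_measure
      ENNReal.ofReal_ne_top
  unfold meanOutput shrink
  simp only [ProbabilityMeasure.coe_mk]
  rw [integral_add_measure hF hd, integral_smul_measure, integral_smul_measure, integral_dirac,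
    ENNReal.toReal_ofReal t.2.1]
  simp

lemma expectedWage_shrink (h0 : (0 : ℝ) ∈ Y) (t : unitInterval) (F : ProbabilityMeasure Y)
    (c : ℝ≥0) (w : Y → ℝ≥0) : expectedWage w (shrink h0 t F, c) =
      ENNReal.ofReal t * expectedWage w (F, c) + ENNReal.ofReal (1 - t) * w ⟨0, h0⟩ := by
  unfold expectedWage shrink
  simp only [ProbabilityMeasure.coe_mk]
  rw [lintegral_add_measure, lintegral_smul_measure, lintegral_smul_measure, lintegral_dirac]
  simp

lemma shrink_one (h0 : (0 : ℝ) ∈ Y) (F : ProbabilityMeasure Y) : shrink h0 1 F = F := by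
  apply Subtype.ext
  simp [shrink]

/-- If the agent can dilute her optimal action with the null output at the floor cost, then the
principal retains at most `V`. -/
lemma meanOutput_le_add_expectedWage (hYc : IsCompact Y) (h0 : (0 : ℝ) ∈ Y) {V : ℝ} (hV : 0 < V)
    {A : Set (Action Y)} {w : Y → ℝ≥0} {a : Action Y} (ha : a ∈ optimalActions A w)
    (hc : costFloor V (meanOutput a) ≤ (a.2 : ℝ))
    (hA : V < meanOutput a → ∀ t : unitInterval, floorAction V (shrink h0 t a.1) ∈ A) :
    ENNReal.ofReal (meanOutput a) ≤ ENNReal.ofReal V + expectedWage w a := by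
  rcases le_or_gt (meanOutput a) V with h | h
  · exact (ENNReal.ofReal_le_ofReal h).trans le_self_add
  by_cases hW : expectedWage w a = ∞
  · simp [hW]
  set e := meanOutput a with he
  set W := (expectedWage w a).toReal with hWdef
  have hepos : 0 < e := hV.trans h
  -- For these `s` the diluted mean `(1 - s) e` stays above `V`, on the logarithmic branch of the
  -- floor.
  have key : ∀ s ∈ Ioo (0 : ℝ) (1 - V / e), e - V / (1 - s) ≤ W := by
    intro s hs
    have hs1 : V / e < 1 - s := by linarith [hs.2]
    have hs1' : 0 < 1 - s := (div_pos hV hepos).trans hs1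
    let t : unitInterval := ⟨1 - s, hs1'.le, by linarith [hs.1]⟩
    have hmem := hA h t
    set b := floorAction V (shrink h0 t a.1) with hb
    have hbm : meanOutput b = (1 - s) * e := meanOutput_shrink hYc h0 t a.1 a.2
    have hbc : (b.2 : ℝ) = costFloor V ((1 - s) * e) := by
      rw [← hbm]
      exact floorAction_cost hV b
    have hbw : expectedWage w b =
        ENNReal.ofReal (1 - s) * expectedWage w a + ENNReal.ofReal (1 - (1 - s)) * w ⟨0, h0⟩ :=
      expectedWage_shrink h0 t a.1 a.2 w
    have hbt : expectedWage w b ≠ ∞ := by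
      rw [hbw]
      exact ENNReal.add_ne_top.2 ⟨ENNReal.mul_ne_top ENNReal.ofReal_ne_top hW,
        ENNReal.mul_ne_top ENNReal.ofReal_ne_top ENNReal.coe_ne_top⟩
    -- Limited liability: the wage `s w(0)` earned on the null output is nonnegative and is dropped.
    have hbW : (1 - s) * W ≤ (expectedWage w b).toReal := by
      have : ENNReal.ofReal (1 - s) * expectedWage w a ≤ expectedWage w b := by
        rw [hbw]
        exact le_self_add
      have := ENNReal.toReal_mono hbt this
      rwa [ENNReal.toReal_mul, ENNReal.toReal_ofReal hs1'.le] at this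
    have hopt := ha.2 b hmem
    rw [agentUtility_of_ne_top hbt, agentUtility_of_ne_top hW, EReal.coe_le_coe_iff, hbc] at hopt
    have hge : V ≤ (1 - s) * e := by
      rw [div_lt_iff₀ hepos] at hs1
      exact hs1.le
    rw [costFloor_of_ge hge] at hopt
    rw [costFloor_of_ge h.le] at hc
    have hlog : Real.log ((1 - s) * e / V) = Real.log (1 - s) + Real.log (e / V) := by
      rw [mul_div_assoc, Real.log_mul hs1'.ne' (div_pos hepos hV).ne']
    rw [hlog] at hopt
    -- The cost saved is at least `s e + V ln (1 - s)`; bounding the logarithm below makes a factor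
    -- `s` cancel.
    have hl := Real.one_sub_inv_le_log_of_pos hs1'
    have h1 : 1 - (1 - s)⁻¹ = - s * (1 - s)⁻¹ := by field_simp; ring
    rw [h1] at hl
    have hl2 := mul_le_mul_of_nonneg_left hl hV.le
    have h2 : s * (e - V / (1 - s)) ≤ s * W := by
      have : s * (e - V / (1 - s)) = s * e + V * (- s * (1 - s)⁻¹) := by
        rw [div_eq_mul_inv]; ring
      rw [this]
      linarith
    exact le_of_mul_le_mul_left h2 hs.1
  have hlim : Tendsto (fun s : ℝ => e - V / (1 - s)) (𝓝[>] 0) (𝓝 (e - V / (1 - 0))) := by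
    refine Tendsto.mono_left (ContinuousAt.tendsto ?_) nhdsWithin_le_nhds
    fun_prop (disch := norm_num)
  have hpos : 0 < 1 - V / e := by
    rw [sub_pos, div_lt_one hepos]
    exact h
  have hle : e - V ≤ W := by
    have := le_of_tendsto hlim
      (eventually_of_mem (Ioo_mem_nhdsGT hpos) key)
    simpa using this
  rw [← ENNReal.ofReal_toReal hW, ← ENNReal.ofReal_add hV.le ENNReal.toReal_nonneg]
  exact ENNReal.ofReal_le_ofReal (by linarith)

lemma principalPayoff_le (hYpos : ∀ y ∈ Y, 0 ≤ y) {V : ℝ} (hV : 0 < V) {w : Y → ℝ≥0}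
    {a : Action Y} (h : ENNReal.ofReal (meanOutput a) ≤ ENNReal.ofReal V + expectedWage w a) :
    principalPayoff w a ≤ (V : EReal) := by
  unfold principalPayoff
  refine EReal.sub_le_of_le_add ?_
  have := EReal.coe_ennreal_le_coe_ennreal_iff.2 h
  rwa [EReal.coe_ennreal_add, EReal.coe_ennreal_ofReal, EReal.coe_ennreal_ofReal,
    max_eq_left hV.le, max_eq_left (meanOutput_nonneg hYpos a)] at this

/-- Responses need not be measurable. In additive form the bound integrates anyway: the lower
integral is monotone, and only the constant has to be measurable to split the sum. -/
lemma expectedPayoff_le {V : ℝ} (hV : 0 < V) {R : RandomContract Y} {a : R.Ω → Action Y}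
    (h : ∀ᵐ ω ∂(R.P), ENNReal.ofReal (meanOutput (a ω)) ≤
      ENNReal.ofReal V + expectedWage (R.wage ω) (a ω)) :
    expectedPayoff R a ≤ (V : EReal) := by
  unfold expectedPayoff
  refine EReal.sub_le_of_le_add ?_
  have h1 := lintegral_mono_ae h
  rw [lintegral_add_left measurable_const, lintegral_const, measure_univ, mul_one] at h1
  have := EReal.coe_ennreal_le_coe_ennreal_iff.2 h1
  rwa [EReal.coe_ennreal_add, EReal.coe_ennreal_ofReal, max_eq_left hV.le] at this

lemma bestPayoff_le {V : ℝ} (hV : 0 < V) {A : Set (Action Y)}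
    (h : ∀ w : Y → ℝ≥0, ∀ a ∈ optimalActions A w,
      ENNReal.ofReal (meanOutput a) ≤ ENNReal.ofReal V + expectedWage w a)
    (R : RandomContract Y) : bestPayoff A R ≤ (V : EReal) :=
  iSup₂_le fun _ ha => expectedPayoff_le hV (Eventually.mono ha fun _ hω => h _ _ hω)

lemma floorAction_shrink_mem_worstTechnology (hYc : IsCompact Y) (hYpos : ∀ y ∈ Y, 0 ≤ y)
    (h0 : (0 : ℝ) ∈ Y) {A₀ : Set (Action Y)} {V : ℝ} (hV : 0 < V) {a : Action Y}
    (ha : meanOutput a ≤ max V (maxMean A₀)) (t : unitInterval) :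
    floorAction V (shrink h0 t a.1) ∈ worstTechnology A₀ V := by
  refine (mem_worstTechnology_iff hV _).2 ⟨?_, (floorAction_cost hV (shrink h0 t a.1, 0)).ge⟩
  have h : meanOutput (floorAction V (shrink h0 t a.1)) = t * meanOutput a :=
    meanOutput_shrink hYc h0 t a.1 a.2
  rw [h]
  exact (mul_le_of_le_one_left (meanOutput_nonneg hYpos a) t.2.2).trans ha

lemma meanOutput_le_of_optimal_worstTechnology (hYc : IsCompact Y) (hYpos : ∀ y ∈ Y, 0 ≤ y)
    (h0 : (0 : ℝ) ∈ Y) {A₀ : Set (Action Y)} {V : ℝ} (hV : 0 < V) (w : Y → ℝ≥0) (a : Action Y)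
    (ha : a ∈ optimalActions (worstTechnology A₀ V) w) :
    ENNReal.ofReal (meanOutput a) ≤ ENNReal.ofReal V + expectedWage w a := by
  have hm := (mem_worstTechnology_iff hV a).1 ha.1
  exact meanOutput_le_add_expectedWage hYc h0 hV ha hm.2
    fun _ t => floorAction_shrink_mem_worstTechnology hYc hYpos h0 hV hm.1 t

lemma continuous_meanOutput (hYc : IsCompact Y) :
    Continuous fun F : ProbabilityMeasure Y => meanOutput (F, 0) := by
  have : CompactSpace Y := isCompact_iff_compactSpace.1 hYc
  exact ProbabilityMeasure.continuous_integral_continuousMap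
    (⟨Subtype.val, continuous_subtype_val⟩ : C(Y, ℝ))

lemma expectedWage_ne_top_of_continuous (hYc : IsCompact Y) {w : Y → ℝ≥0} (hw : Continuous w)
    (a : Action Y) : expectedWage w a ≠ ∞ := by
  have : CompactSpace Y := isCompact_iff_compactSpace.1 hYc
  exact (BoundedContinuousFunction.lintegral_lt_top_of_nnreal (a.1 : Measure Y)
    (BoundedContinuousFunction.mkOfCompact ⟨w, hw⟩)).ne

/-- Only floor costs matter, so the problem is to maximize wage minus floor over the distributions
with capped mean. These form a weakly compact set, and the objective is weakly continuous when `w`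
is continuous. -/
lemma optimalActions_worstTechnology_nonempty (hYc : IsCompact Y) (h0 : (0 : ℝ) ∈ Y)
    {A₀ : Set (Action Y)} {V : ℝ} (hV : 0 < V) {w : Y → ℝ≥0} (hw : Continuous w) :
    (optimalActions (worstTechnology A₀ V) w).Nonempty := by
  have : CompactSpace Y := isCompact_iff_compactSpace.1 hYc
  have hfin := expectedWage_ne_top_of_continuous hYc hw
  have hmc := continuous_meanOutput hYc
  have hwc : Continuous fun F : ProbabilityMeasure Y => expectedWage w (F, 0) :=
    ProbabilityMeasure.continuous_lintegral_continuousMap (⟨w, hw⟩ : C(Y, ℝ≥0))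
  have hwc' : Continuous fun F : ProbabilityMeasure Y => (expectedWage w (F, 0)).toReal :=
    ENNReal.continuousOn_toReal.comp_continuous hwc fun F => hfin (F, 0)
  have hK : IsCompact {F : ProbabilityMeasure Y | meanOutput (F, 0) ≤ max V (maxMean A₀)} :=
    (isClosed_le hmc continuous_const).isCompact
  have hne : {F : ProbabilityMeasure Y | meanOutput (F, 0) ≤ max V (maxMean A₀)}.Nonempty :=
    ⟨(nullAction h0).1, (meanOutput_nullAction h0).trans_le (hV.le.trans (le_max_left _ _))⟩
  obtain ⟨F, hFK, hF⟩ := hK.exists_isMaxOn hne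
    (hwc'.sub ((continuous_costFloor hV).comp hmc)).continuousOn
  refine ⟨floorAction V F, (mem_worstTechnology_iff hV _).2
    ⟨hFK, (floorAction_cost hV (F, 0)).ge⟩, fun b hb => ?_⟩
  have hb' := (mem_worstTechnology_iff hV b).1 hb
  rw [agentUtility_of_ne_top (hfin _), agentUtility_of_ne_top (hfin _), EReal.coe_le_coe_iff,
    floorAction_cost hV (F, 0)]
  have h1 := isMaxOn_iff.1 hF b.1 hb'.1
  have h2 : costFloor V (meanOutput (b.1, 0)) ≤ (b.2 : ℝ) := hb'.2
  have h3 : (expectedWage w (b.1, 0)).toReal = (expectedWage w b).toReal := rfl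
  have h4 : (expectedWage w (floorAction V F)).toReal = (expectedWage w (F, 0)).toReal := rfl
  change (expectedWage w (b.1, 0)).toReal - costFloor V (meanOutput (b.1, 0)) ≤
    (expectedWage w (F, 0)).toReal - costFloor V (meanOutput (F, 0)) at h1
  linarith

/-- The known technology together with the dilutions of its members at the floor cost. -/
def dilutedTechnology (h0 : (0 : ℝ) ∈ Y) (A₀ : Set (Action Y)) (V : ℝ) : Set (Action Y) :=
  A₀ ∪ {b | ∃ a ∈ A₀, ∃ t : unitInterval, b = floorAction V (shrink h0 t a.1)}

/-- Makes `dilutedTechnology` closed under further dilution, as the bound on the principal's payoff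
requires. -/
lemma shrink_shrink (h0 : (0 : ℝ) ∈ Y) (s t : unitInterval) (F : ProbabilityMeasure Y) :
    shrink h0 s (shrink h0 t F) = shrink h0 (s * t) F := by
  apply Subtype.ext
  have hs := s.2
  have ht := t.2
  simp only [shrink, smul_add, smul_smul, add_assoc, ← add_smul, Set.Icc.coe_mul,
    ← ENNReal.ofReal_mul hs.1, ProbabilityMeasure.coe_mk]
  rw [← ENNReal.ofReal_add (mul_nonneg hs.1 (sub_nonneg.2 ht.2)) (sub_nonneg.2 hs.2)]
  congr 3
  ring_nf

/-- Along the dilutions of one action, the expected wage is affine in the weight `t` even if `w` is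
discontinuous. If it is finite, utility is continuous in `t`, and there are only finitely many such
compact segments. -/
lemma optimalActions_dilutedTechnology_nonempty (hYc : IsCompact Y) (h0 : (0 : ℝ) ∈ Y)
    {A₀ : Set (Action Y)} (hfin : A₀.Finite) (hne : A₀.Nonempty) {V : ℝ} (hV : 0 < V)
    (hA₀ : A₀ ⊆ worstTechnology A₀ V) (w : Y → ℝ≥0) :
    (optimalActions (dilutedTechnology h0 A₀ V) w).Nonempty := by
  by_cases htop : ∃ a ∈ A₀, expectedWage w a = ∞
  · obtain ⟨a, ha, hw⟩ := htop
    exact ⟨a, Or.inl ha, fun b _ => by rw [agentUtility_of_eq_top hw]; exact le_top⟩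
  push Not at htop
  let f (a : Action Y) (t : unitInterval) : ℝ :=
    t * (expectedWage w a).toReal + (1 - t) * w ⟨0, h0⟩ - costFloor V (t * meanOutput a)
  have hf : ∀ a ∈ A₀, ∀ t, agentUtility w (floorAction V (shrink h0 t a.1)) = (f a t : EReal) := by
    intro a ha t
    have hw : expectedWage w (floorAction V (shrink h0 t a.1)) =
        ENNReal.ofReal t * expectedWage w a + ENNReal.ofReal (1 - t) * w ⟨0, h0⟩ :=
      expectedWage_shrink h0 t a.1 a.2 w
    have h1 := ENNReal.mul_ne_top (ENNReal.ofReal_ne_top (r := (t : ℝ))) (htop a ha)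
    have h2 : ENNReal.ofReal (1 - t) * w ⟨0, h0⟩ ≠ ∞ :=
      ENNReal.mul_ne_top ENNReal.ofReal_ne_top ENNReal.coe_ne_top
    have hm : meanOutput (shrink h0 t a.1, a.2) = t * meanOutput a :=
      meanOutput_shrink hYc h0 t a.1 a.2
    rw [agentUtility_of_ne_top (by rw [hw]; exact ENNReal.add_ne_top.2 ⟨h1, h2⟩), hw,
      floorAction_cost hV (shrink h0 t a.1, a.2), hm, ENNReal.toReal_add h1 h2,
      ENNReal.toReal_mul, ENNReal.toReal_mul, ENNReal.toReal_ofReal t.2.1,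
      ENNReal.toReal_ofReal (sub_nonneg.2 t.2.2)]
    rfl
  have hcont : ∀ a, Continuous (f a) := by
    intro a
    have := continuous_costFloor hV
    fun_prop
  have hmax : ∀ a, ∃ t, ∀ s, f a s ≤ f a t := by
    intro a
    obtain ⟨t, -, ht⟩ := isCompact_univ.exists_isMaxOn univ_nonempty (hcont a).continuousOn
    exact ⟨t, fun s => isMaxOn_iff.1 ht s (mem_univ s)⟩
  choose τ hτ using hmax
  obtain ⟨a, ha, hmax⟩ := hfin.exists_maximalFor (fun a => f a (τ a)) A₀ hne
  have hle : ∀ b ∈ A₀, ∀ s, f b s ≤ f a (τ a) := by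
    intro b hb s
    refine (hτ b s).trans ?_
    rcases le_total (f b (τ b)) (f a (τ a)) with h | h
    · exact h
    · exact hmax hb h
  refine ⟨floorAction V (shrink h0 (τ a) a.1), Or.inr ⟨a, ha, _, rfl⟩, ?_⟩
  rintro b (hb | ⟨b, hb, s, rfl⟩)
  -- A known action is weakly dominated by its own dilution with `t = 1`: same distribution, floor
  -- cost.
  · refine le_trans ?_ ((hf b hb 1).trans_le
      ((EReal.coe_le_coe_iff.2 (hle b hb 1)).trans (hf a ha _).ge))
    rw [shrink_one, agentUtility_of_ne_top (htop b hb),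
      agentUtility_of_ne_top (by rw [expectedWage_floorAction]; exact htop b hb),
      expectedWage_floorAction, floorAction_cost hV, EReal.coe_le_coe_iff]
    exact sub_le_sub_left ((mem_worstTechnology_iff hV b).1 (hA₀ hb)).2 _
  · rw [hf b hb, hf a ha, EReal.coe_le_coe_iff]
    exact hle b hb s

lemma dilutedTechnology_subset (hYc : IsCompact Y) (hYpos : ∀ y ∈ Y, 0 ≤ y) (h0 : (0 : ℝ) ∈ Y)
    {A₀ : Set (Action Y)} {V : ℝ} (hV : 0 < V) (hA₀ : A₀ ⊆ worstTechnology A₀ V) :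
    dilutedTechnology h0 A₀ V ⊆ worstTechnology A₀ V := by
  rintro b (hb | ⟨a, ha, t, rfl⟩)
  · exact hA₀ hb
  · exact floorAction_shrink_mem_worstTechnology hYc hYpos h0 hV
      ((mem_worstTechnology_iff hV a).1 (hA₀ ha)).1 t

lemma meanOutput_le_of_optimal_dilutedTechnology (hYc : IsCompact Y) (hYpos : ∀ y ∈ Y, 0 ≤ y)
    (h0 : (0 : ℝ) ∈ Y) {A₀ : Set (Action Y)} {V : ℝ} (hV : 0 < V)
    (hA₀ : A₀ ⊆ worstTechnology A₀ V) (w : Y → ℝ≥0) (a : Action Y)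
    (ha : a ∈ optimalActions (dilutedTechnology h0 A₀ V) w) :
    ENNReal.ofReal (meanOutput a) ≤ ENNReal.ofReal V + expectedWage w a := by
  have hm := (mem_worstTechnology_iff hV a).1 (dilutedTechnology_subset hYc hYpos h0 hV hA₀ ha.1)
  refine meanOutput_le_add_expectedWage hYc h0 hV ha hm.2 fun _ t => Or.inr ?_
  rcases ha.1 with h | ⟨b, hb, s, rfl⟩
  · exact ⟨a, h, t, rfl⟩
  · exact ⟨b, hb, t * s, by rw [← shrink_shrink]; rfl⟩

lemma responses_nonempty {A : Set (Action Y)} {R : RandomContract Y}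
    (h : ∀ w : Y → ℝ≥0, (optimalActions A w).Nonempty) : (responses A R).Nonempty := by
  choose a ha using h
  exact ⟨fun ω => a (R.wage ω), ae_of_all _ fun ω => ha _⟩

/-- Without a response the infimum would be `⊤` and the supremum `⊥`. -/
lemma worstPayoff_le_bestPayoff {A : Set (Action Y)} {R : RandomContract Y}
    (h : (responses A R).Nonempty) : worstPayoff A R ≤ bestPayoff A R := by
  obtain ⟨a, ha⟩ := h
  exact (iInf₂_le a ha).trans (le_iSup₂ (f := fun a (_ : a ∈ responses A R) => expectedPayoff R a)
    a ha)

lemma worstGuarantee_le_bestGuarantee {A₀ : Set (Action Y)} (R : RandomContract Y) :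
    worstGuarantee A₀ R ≤ bestGuarantee A₀ R :=
  iInf₂_mono fun _ hA => worstPayoff_le_bestPayoff hA.2

end UpperBound

/-! ### The ratio and the known technology -/

section Ratio

variable {Y : Set ℝ} {A₀ : Set (Action Y)}

lemma neg_log_one_sub_pos {α : ℝ} (hα : α ∈ Ioo (0 : ℝ) 1) : 0 < -Real.log (1 - α) :=
  neg_pos.2 (Real.log_neg (by linarith [hα.2]) (by linarith [hα.1]))

lemma tendsto_div_neg_log_one_sub :
    Tendsto (fun β : ℝ => β / (-Real.log (1 - β))) (𝓝[>] 0) (𝓝 1) := by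
  have hd : HasDerivAt (fun β : ℝ => -Real.log (1 - β)) 1 0 := by
    have := (((hasDerivAt_id (0 : ℝ)).const_sub 1).log (by simp)).neg
    refine this.congr_deriv (by simp)
  have h := hd.tendsto_slope_zero_right
  have h' := h.inv₀ one_ne_zero
  simpa [div_eq_mul_inv, mul_comm] using h'

/-- Near slope `0` only the costless known actions matter. -/
lemma exists_costless_eventually_uLow_eq (hYc : IsCompact Y) (hYpos : ∀ y ∈ Y, 0 ≤ y)
    (h0 : (0 : ℝ) ∈ Y) (hfin : A₀.Finite) (hnull : nullAction h0 ∈ A₀) :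
    ∃ a ∈ A₀, a.2 = 0 ∧ (∀ b ∈ A₀, b.2 = 0 → meanOutput b ≤ meanOutput a) ∧
      ∀ᶠ β in 𝓝[>] (0 : ℝ), uLow A₀ β = β * meanOutput a := by
  obtain ⟨a, ⟨ha, hac⟩, hmax⟩ := (hfin.subset (sep_subset A₀ fun a => a.2 = 0)).exists_maximalFor
    meanOutput _ ⟨_, hnull, rfl⟩
  have hle : ∀ b ∈ A₀, b.2 = 0 → meanOutput b ≤ meanOutput a := fun b hb hbc =>
    (le_total _ _).elim id fun h => hmax ⟨hb, hbc⟩ h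
  refine ⟨a, ha, hac, hle, ?_⟩
  have hev : ∀ᶠ β in 𝓝[>] (0 : ℝ), ∀ b ∈ A₀, β * meanOutput b - (b.2 : ℝ) ≤ β * meanOutput a := by
    rw [hfin.eventually_all]
    intro b hb
    rcases eq_or_ne b.2 0 with hbc | hbc
    · filter_upwards [self_mem_nhdsWithin] with β hβ
      rw [hbc, NNReal.coe_zero, sub_zero]
      exact mul_le_mul_of_nonneg_left (hle b hb hbc) (mem_Ioi.1 hβ).le
    -- A costly action has negative utility once `β` is small.
    · have hpos : (0 : ℝ) < b.2 := NNReal.coe_pos.2 (pos_iff_ne_zero.2 hbc)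
      have ht : Tendsto (fun β : ℝ => β * meanOutput b) (𝓝[>] 0) (𝓝 (0 * meanOutput b)) :=
        (tendsto_id.mul_const _).mono_left nhdsWithin_le_nhds
      rw [zero_mul] at ht
      filter_upwards [ht.eventually_lt_const hpos, self_mem_nhdsWithin] with β hβ hβ0
      have := mul_nonneg (mem_Ioi.1 hβ0).le (meanOutput_nonneg hYpos a)
      linarith
  filter_upwards [hev] with β hβ
  refine le_antisymm (uLow_le ⟨a, ha⟩ hβ) ?_
  have := le_uLow hYc ha β
  rwa [hac, NNReal.coe_zero, sub_zero] at this

lemma tendsto_quotient_zero {m : ℝ} (h : ∀ᶠ β in 𝓝[>] (0 : ℝ), uLow A₀ β = β * m) :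
    Tendsto (fun β => uLow A₀ β / (-Real.log (1 - β))) (𝓝[>] 0) (𝓝 m) := by
  have := tendsto_div_neg_log_one_sub.const_mul m
  rw [mul_one] at this
  refine this.congr' ?_
  filter_upwards [h] with β hβ
  rw [hβ]
  ring

lemma ratio_zero_eq {m : ℝ} (h : ∀ᶠ β in 𝓝[>] (0 : ℝ), uLow A₀ β = β * m) :
    ratio A₀ 0 = m := by
  rw [ratio, if_pos rfl]
  exact (tendsto_quotient_zero h).limUnder_eq

lemma ratio_of_mem_Ioo {α : ℝ} (hα : α ∈ Ioo (0 : ℝ) 1) :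
    ratio A₀ α = uLow A₀ α / (-Real.log (1 - α)) := by
  rw [ratio, if_neg hα.1.ne', if_neg hα.2.ne]

lemma ratio_one : ratio A₀ 1 = 0 := by
  rw [ratio, if_neg one_ne_zero, if_pos rfl]

/-- Both endpoint values are limits: at `1` the numerator converges while the denominator tends to
infinity. -/
lemma continuousOn_ratio (hYc : IsCompact Y) (hA : A₀.Nonempty)
    (h0 : Tendsto (fun β => uLow A₀ β / (-Real.log (1 - β))) (𝓝[>] 0) (𝓝 (ratio A₀ 0))) :
    ContinuousOn (ratio A₀) (Icc 0 1) := by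
  have hu := continuous_uLow hA hYc
  intro α hα
  rcases hα.1.eq_or_lt with rfl | hpos
  · have h1 : ContinuousWithinAt (ratio A₀) (Ioi 0) 0 := by
      refine h0.congr' ?_
      filter_upwards [Ioo_mem_nhdsGT (zero_lt_one' ℝ)] with β hβ
      exact (ratio_of_mem_Ioo hβ).symm
    exact (continuousWithinAt_Ioi_iff_Ici.1 h1).mono fun β hβ => hβ.1
  rcases hα.2.eq_or_lt with rfl | hlt
  · have h1 : ContinuousWithinAt (ratio A₀) (Iio 1) 1 := by
      rw [ContinuousWithinAt, ratio_one]
      have ht : Tendsto (fun β : ℝ => 1 - β) (𝓝[<] 1) (𝓝[>] 0) := by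
        refine tendsto_nhdsWithin_iff.2 ⟨?_, ?_⟩
        · refine Tendsto.mono_left ?_ nhdsWithin_le_nhds
          exact (by fun_prop : Continuous fun β : ℝ => 1 - β).tendsto' 1 0 (by simp)
        · filter_upwards [self_mem_nhdsWithin] with β hβ
          exact sub_pos.2 (mem_Iio.1 hβ)
      have hl := tendsto_neg_atBot_atTop.comp (Real.tendsto_log_nhdsGT_zero.comp ht)
      refine ((hu.tendsto 1).mono_left nhdsWithin_le_nhds |>.div_atTop hl).congr' ?_
      filter_upwards [Ioo_mem_nhdsLT (zero_lt_one' ℝ)] with β hβ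
      exact (ratio_of_mem_Ioo hβ).symm
    exact (continuousWithinAt_Iio_iff_Iic.1 h1).mono fun β hβ => hβ.2
  · have hmem : α ∈ Ioo (0 : ℝ) 1 := ⟨hpos, hlt⟩
    refine ContinuousAt.continuousWithinAt ?_
    have hc : ContinuousAt (fun β => uLow A₀ β / (-Real.log (1 - β))) α := by
      refine hu.continuousAt.div ?_ (neg_log_one_sub_pos hmem).ne'
      exact (ContinuousAt.log (by fun_prop) (sub_pos.2 hlt).ne').neg
    refine hc.congr ?_
    filter_upwards [Ioo_mem_nhds hpos hlt] with β hβ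
    exact (ratio_of_mem_Ioo hβ).symm

/-- The surplus-generating action makes `uLow A₀` positive at slope `1`, hence also just below it.
-/
lemma ratio_pos_of_isMaxOn (hYc : IsCompact Y)
    (hnontriv : ∃ a ∈ A₀, 0 < meanOutput a - (a.2 : ℝ)) {αs : ℝ}
    (hmax : IsMaxOn (ratio A₀) (Icc 0 1) αs) : 0 < ratio A₀ αs := by
  obtain ⟨a, ha, hpos⟩ := hnontriv
  have h1 : 0 < uLow A₀ 1 := hpos.trans_le (by simpa using le_uLow hYc ha 1)
  have hev : ∀ᶠ β in 𝓝[<] (1 : ℝ), 0 < uLow A₀ β :=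
    (((continuous_uLow ⟨a, ha⟩ hYc).tendsto 1).mono_left nhdsWithin_le_nhds).eventually_const_lt h1
  obtain ⟨β, hβ, hβm⟩ := (hev.and (Ioo_mem_nhdsLT (zero_lt_one' ℝ))).exists
  refine lt_of_lt_of_le ?_ (isMaxOn_iff.1 hmax β (Ioo_subset_Icc_self hβm))
  rw [ratio_of_mem_Ioo hβm]
  exact div_pos hβ (neg_log_one_sub_pos hβm)

/-- For mean `e > V`, test the ratio at the slope `α = 1 - V / e` with `e*(α) = e`: there `e - V - c
≤ uLow A₀ α ≤ V ln (e / V)`. -/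
lemma costFloor_le_cost (hYc : IsCompact Y) {V : ℝ} (hV : 0 < V)
    (hmax : ∀ α ∈ Ioo (0 : ℝ) 1, ratio A₀ α ≤ V) {a : Action Y} (ha : a ∈ A₀) :
    costFloor V (meanOutput a) ≤ (a.2 : ℝ) := by
  rcases le_or_gt (meanOutput a) V with h | h
  · rw [costFloor_of_le hV h]
    exact a.2.2
  have hpos : 0 < meanOutput a := hV.trans h
  have hα : 1 - V / meanOutput a ∈ Ioo (0 : ℝ) 1 :=
    ⟨by rw [sub_pos, div_lt_one hpos]; exact h, by linarith [div_pos hV hpos]⟩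
  have h1 := hmax _ hα
  rw [ratio_of_mem_Ioo hα, div_le_iff₀ (neg_log_one_sub_pos hα)] at h1
  have h2 := le_uLow hYc ha (1 - V / meanOutput a)
  rw [costFloor_of_ge h.le]
  have h3 : (1 - V / meanOutput a) * meanOutput a = meanOutput a - V := by field_simp
  have h4 : Real.log (1 - (1 - V / meanOutput a)) = - Real.log (meanOutput a / V) := by
    rw [sub_sub_cancel, ← Real.log_inv, inv_div]
  rw [h4] at h1
  rw [h3] at h2
  linarith

lemma subset_worstTechnology (hYc : IsCompact Y) (hfin : A₀.Finite) {V : ℝ} (hV : 0 < V)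
    (hmax : ∀ α ∈ Ioo (0 : ℝ) 1, ratio A₀ α ≤ V) : A₀ ⊆ worstTechnology A₀ V := fun a ha =>
  (mem_worstTechnology_iff hV a).2
    ⟨(le_csSup (hfin.image _).bddAbove ⟨a, ha, rfl⟩).trans (le_max_right _ _),
      costFloor_le_cost hYc hV hmax ha⟩

/-- For `e > V`, `ln x ≤ x - 1` at `x = √e / √V` puts the floor above `(√e - √V)²`, so `√c ≥ √e -
√V`. -/
lemma sq_sqrt_sub_sqrt_le {V e c : ℝ} (hV : 0 < V) (hc0 : 0 ≤ c) (hce : c ≤ e)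
    (hc : costFloor V e ≤ c) : (√e - √c) ^ 2 ≤ V := by
  have he0 : 0 ≤ e := hc0.trans hce
  have hcs : √c ≤ √e := Real.sqrt_le_sqrt hce
  rw [← Real.sq_sqrt hV.le]
  refine pow_le_pow_left₀ (sub_nonneg.2 hcs) ?_ 2
  rcases le_or_gt e V with h | h
  · linarith [Real.sqrt_le_sqrt h, Real.sqrt_nonneg c]
  have hsV : 0 < √V := Real.sqrt_pos.2 hV
  have hse : 0 < √e := Real.sqrt_pos.2 (hV.trans h)
  have hlog : Real.log (e / V) = 2 * Real.log (√e / √V) := by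
    rw [← Real.log_rpow (div_pos hse hsV), ← Real.sqrt_div he0]
    norm_num [Real.sq_sqrt (div_nonneg he0 hV.le)]
  have hl := Real.log_le_sub_one_of_pos (div_pos hse hsV)
  have h1 : (√e - √V) ^ 2 ≤ c := by
    refine le_trans ?_ hc
    rw [costFloor_of_ge h.le, hlog]
    have h2 := mul_le_mul_of_nonneg_left hl hV.le
    have h3 : V * (√e / √V - 1) = √e * √V - V := by
      have : V * (√e / √V) = √e * √V := by
        rw [← mul_div_assoc, div_eq_iff hsV.ne', mul_assoc, Real.mul_self_sqrt hV.le]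
        ring
      rw [mul_sub, this, mul_one]
    rw [h3] at h2
    have h4 : (√e - √V) ^ 2 = e + V - 2 * (√e * √V) := by
      rw [sub_sq, Real.sq_sqrt he0, Real.sq_sqrt hV.le]
      ring
    linarith
  have := Real.le_sqrt_of_sq_le h1
  linarith

end Ratio

/-! ### The law of the random slope -/

section SlopeDistribution

/-- The distribution of the slope in the optimal contract when `0 < αs < 1`. -/
def slopeMeasure (αs : ℝ) : Measure ℝ :=
  (volume.restrict (Ioc 0 αs)).withDensity
    fun α => ENNReal.ofReal (((1 - α) * (-Real.log (1 - αs)))⁻¹)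

lemma slopeMeasure_absolutelyContinuous (αs : ℝ) : slopeMeasure αs ≪ volume :=
  (withDensity_absolutelyContinuous _ _).trans Measure.absolutelyContinuous_restrict

lemma slopeMeasure_apply_Iic {αs : ℝ} (hαs : αs ∈ Ioo (0 : ℝ) 1) {x : ℝ} (hx0 : 0 ≤ x)
    (hx : x ≤ αs) : slopeMeasure αs (Iic x) =
      ENNReal.ofReal (Real.log (1 - x) / Real.log (1 - αs)) := by
  have hL := neg_log_one_sub_pos hαs
  have hx1 : x < 1 := hx.trans_lt hαs.2
  have hset : Iic x ∩ Ioc 0 αs = Ioc 0 x := by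
    ext t
    simp only [mem_inter_iff, mem_Iic, mem_Ioc]
    exact ⟨fun h => ⟨h.2.1, h.1⟩, fun h => ⟨h.2, h.1, h.2.trans hx⟩⟩
  -- The density has the shape of `e*`, so its integral is already known.
  have hfun : (fun t : ℝ => ((1 - t) * (-Real.log (1 - αs)))⁻¹) =
      eStar (-Real.log (1 - αs))⁻¹ := by
    ext t
    rw [eStar, mul_inv, mul_comm, div_eq_mul_inv]
  have hint : IntegrableOn (eStar (-Real.log (1 - αs))⁻¹) (Ioc 0 x) := by
    refine (ContinuousOn.integrableOn_Icc ?_).mono_set Ioc_subset_Icc_self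
    unfold eStar
    exact ContinuousOn.div (by fun_prop) (by fun_prop) fun t ht => by linarith [ht.2]
  rw [slopeMeasure, withDensity_apply _ measurableSet_Iic,
    Measure.restrict_restrict measurableSet_Iic, hset,
    ← ofReal_integral_eq_lintegral_ofReal (by rw [hfun]; exact hint), hfun,
    ← intervalIntegral.integral_of_le hx0, integral_eStar hx1 hx0]
  · congr 1
    rw [inv_neg, neg_neg, div_eq_mul_inv, mul_comm]
  · refine (ae_restrict_iff' measurableSet_Ioc).2 (ae_of_all _ fun t ht => ?_)
    exact inv_nonneg.2 (mul_nonneg (by linarith [ht.2]) hL.le)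

lemma ae_slopeMeasure_mem (αs : ℝ) : ∀ᵐ α ∂(slopeMeasure αs), α ∈ Ioc 0 αs :=
  (withDensity_absolutelyContinuous _ _).ae_le (ae_restrict_mem measurableSet_Ioc)

lemma slopeMeasure_apply_of_le {αs : ℝ} (hαs : αs ∈ Ioo (0 : ℝ) 1) {s : Set ℝ}
    (hs : Iic αs ⊆ s) : slopeMeasure αs s = 1 := by
  have h : s =ᵐ[slopeMeasure αs] Iic αs := by
    filter_upwards [ae_slopeMeasure_mem αs] with α hα
    exact propext ⟨fun _ => hα.2, fun h => hs h⟩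
  rw [measure_congr h, slopeMeasure_apply_Iic hαs hαs.1.le le_rfl, div_self, ENNReal.ofReal_one]
  exact (neg_ne_zero.1 (neg_log_one_sub_pos hαs).ne')

/-- The distribution of the slope in the optimal contract as a probability measure. -/
def slopeDistribution {αs : ℝ} (hαs : αs ∈ Ioo (0 : ℝ) 1) : ProbabilityMeasure ℝ :=
  ⟨slopeMeasure αs, ⟨slopeMeasure_apply_of_le hαs (subset_univ _)⟩⟩

lemma cdf_slopeDistribution {αs : ℝ} (hαs : αs ∈ Ioo (0 : ℝ) 1) (α : ℝ) :
    ProbabilityTheory.cdf (slopeDistribution hαs : Measure ℝ) α = gStar αs α := by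
  rw [ProbabilityTheory.cdf_eq_real, measureReal_def]
  change (slopeMeasure αs (Iic α)).toReal = _
  unfold gStar
  split_ifs with h1 h2
  · have : slopeMeasure αs (Iic α) = 0 := by
      refine measure_eq_zero_iff_ae_notMem.2 ?_
      filter_upwards [ae_slopeMeasure_mem αs] with β hβ
      exact fun h => absurd (hβ.1.trans_le (mem_Iic.1 h)) (not_lt.2 h1.le)
    rw [this, ENNReal.toReal_zero]
  · rw [slopeMeasure_apply_of_le hαs (Iic_subset_Iic.2 h2), ENNReal.toReal_one]
  · push Not at h1 h2
    rw [slopeMeasure_apply_Iic hαs h1 h2.le, ENNReal.toReal_ofReal]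
    rw [← neg_div_neg_eq]
    refine div_nonneg (neg_nonneg.2 ?_) (neg_log_one_sub_pos hαs).le
    exact Real.log_nonpos (by linarith [hαs.2]) (by linarith)

lemma cdf_dirac_zero (α : ℝ) :
    ProbabilityTheory.cdf (Measure.dirac (0 : ℝ)) α = gStar 0 α := by
  rw [ProbabilityTheory.cdf_eq_real, measureReal_def, Measure.dirac_apply' _ measurableSet_Iic]
  unfold gStar
  split_ifs with h1 h2
  · rw [indicator_of_notMem (by simpa using h1), ENNReal.toReal_zero]
  · rw [indicator_of_mem (by simpa using h2), Pi.one_apply, ENNReal.toReal_one]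
  · exact absurd (not_lt.1 h1) h2

/-- The density is built to cancel the share `1 - α` that the principal retains. -/
lemma integral_slopeMeasure {αs : ℝ} (hαs : αs ∈ Ioo (0 : ℝ) 1) (f : ℝ → ℝ) :
    ∫ α, (1 - α) * f α ∂(slopeMeasure αs) = (∫ α in (0 : ℝ)..αs, f α) / (-Real.log (1 - αs)) := by
  have hL := neg_log_one_sub_pos hαs
  rw [slopeMeasure, integral_withDensity_eq_integral_toReal_smul (by fun_prop)
    (ae_of_all _ fun _ => ENNReal.ofReal_lt_top), intervalIntegral.integral_of_le hαs.1.le,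
    ← integral_div]
  refine setIntegral_congr_fun measurableSet_Ioc fun α hα => ?_
  have h1 : 0 < 1 - α := by linarith [hα.2, hαs.2]
  simp only [smul_eq_mul]
  rw [ENNReal.toReal_ofReal (inv_nonneg.2 (mul_nonneg h1.le hL.le))]
  field_simp

end SlopeDistribution

/-! ### The lower bound by the envelope theorem -/

section LowerBound

variable {Y : Set ℝ}

/-- The payoff is the same for all responses: the slope law has a density, so it ignores the null
set of slopes where `uLow A` has a kink and ties could matter. -/
lemma expectedPayoff_slopeDistribution (hYc : IsCompact Y) (hYpos : ∀ y ∈ Y, 0 ≤ y)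
    (h0 : (0 : ℝ) ∈ Y) {A : Set (Action Y)} (hnull : nullAction h0 ∈ A) {αs : ℝ}
    (hαs : αs ∈ Ioo (0 : ℝ) 1) {a : ℝ → Action Y}
    (ha : a ∈ responses A (randomLinear Y (slopeDistribution hαs))) :
    expectedPayoff (randomLinear Y (slopeDistribution hαs)) a =
      ((uLow A αs / (-Real.log (1 - αs)) : ℝ) : EReal) := by
  obtain ⟨B, hB⟩ := exists_output_bound hYc
  have hlip := lipschitzWith_uLow ⟨_, hnull⟩ hYc hB
  have : IsProbabilityMeasure (slopeMeasure αs) := (slopeDistribution hαs).2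
  have hopt : ∀ᵐ α ∂(slopeMeasure αs), a α ∈ optimalActions A (linearContract α) := ha
  have hdiff : ∀ᵐ α ∂(slopeMeasure αs), DifferentiableAt ℝ (uLow A) α :=
    (slopeMeasure_absolutelyContinuous αs).ae_le hlip.ae_differentiableAt_real
  -- This also replaces the possibly nonmeasurable response by a measurable function.
  have hmean : ∀ᵐ α ∂(slopeMeasure αs), meanOutput (a α) = deriv (uLow A) α := by
    filter_upwards [hopt, hdiff, ae_slopeMeasure_mem αs] with α h1 h2 h3
    exact (deriv_uLow_eq_meanOutput hYc hYpos h3.1.le h1 h2).symm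
  have hwage : ∀ᵐ α ∂(slopeMeasure αs),
      expectedWage (linearContract α) (a α) = ENNReal.ofReal (α * deriv (uLow A) α) := by
    filter_upwards [hmean, ae_slopeMeasure_mem αs] with α h1 h3
    rw [expectedWage_linearContract hYc hYpos h3.1.le, h1]
  have hderiv_nonneg : ∀ᵐ α ∂(slopeMeasure αs), 0 ≤ deriv (uLow A) α := by
    filter_upwards [hmean] with α h1
    rw [← h1]
    exact meanOutput_nonneg hYpos _
  have hint : Integrable (deriv (uLow A)) (slopeMeasure αs) :=
    Integrable.of_bound (measurable_deriv _).aestronglyMeasurable (B : ℝ)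
      (ae_of_all _ fun _ => norm_deriv_le_of_lipschitz hlip)
  have hint' : Integrable (fun α => α * deriv (uLow A) α) (slopeMeasure αs) := by
    refine hint.mono' (by fun_prop) ?_
    filter_upwards [hderiv_nonneg, ae_slopeMeasure_mem αs] with α h1 h3
    rw [Real.norm_of_nonneg (mul_nonneg h3.1.le h1)]
    exact mul_le_of_le_one_left h1 (h3.2.trans hαs.2.le)
  have hwage_nonneg : ∀ᵐ α ∂(slopeMeasure αs), 0 ≤ α * deriv (uLow A) α := by
    filter_upwards [hderiv_nonneg, ae_slopeMeasure_mem αs] with α h1 h3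
    exact mul_nonneg h3.1.le h1
  have e1 : ∫⁻ α, ENNReal.ofReal (meanOutput (a α)) ∂(slopeMeasure αs) =
      ENNReal.ofReal (∫ α, deriv (uLow A) α ∂(slopeMeasure αs)) := by
    rw [ofReal_integral_eq_lintegral_ofReal hint hderiv_nonneg]
    exact lintegral_congr_ae (hmean.mono fun α h => by simp only [h])
  have e2 : ∫⁻ α, expectedWage (linearContract α) (a α) ∂(slopeMeasure αs) =
      ENNReal.ofReal (∫ α, α * deriv (uLow A) α ∂(slopeMeasure αs)) := by
    rw [ofReal_integral_eq_lintegral_ofReal hint' hwage_nonneg]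
    exact lintegral_congr_ae hwage
  have e3 : expectedPayoff (randomLinear Y (slopeDistribution hαs)) a =
      ((∫⁻ α, ENNReal.ofReal (meanOutput (a α)) ∂(slopeMeasure αs) : ℝ≥0∞) : EReal) -
        ((∫⁻ α, expectedWage (linearContract α) (a α) ∂(slopeMeasure αs) : ℝ≥0∞) : EReal) := rfl
  rw [e3, e1, e2, EReal.coe_ennreal_ofReal, EReal.coe_ennreal_ofReal,
    max_eq_left (integral_nonneg_of_ae hderiv_nonneg),
    max_eq_left (integral_nonneg_of_ae hwage_nonneg), ← EReal.coe_sub, ← integral_sub hint hint']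
  have e4 : (fun α => deriv (uLow A) α - α * deriv (uLow A) α) =
      fun α => (1 - α) * deriv (uLow A) α := by
    ext α
    ring
  have hac : AbsolutelyContinuousOnInterval (uLow A) 0 αs :=
    (hlip.lipschitzOnWith (s := uIcc 0 αs)).absolutelyContinuousOnInterval
  rw [e4, integral_slopeMeasure hαs, hac.integral_deriv_eq_sub, uLow_zero hYc h0 hnull, sub_zero]

lemma le_worstGuarantee_slopeDistribution (hYc : IsCompact Y) (hYpos : ∀ y ∈ Y, 0 ≤ y)
    (h0 : (0 : ℝ) ∈ Y) {A₀ : Set (Action Y)} (hnull : nullAction h0 ∈ A₀) {αs : ℝ}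
    (hαs : αs ∈ Ioo (0 : ℝ) 1) : ((ratio A₀ αs : ℝ) : EReal) ≤
      worstGuarantee A₀ (randomLinear Y (slopeDistribution hαs)) := by
  refine le_iInf₂ fun A hA => le_iInf₂ fun a ha => ?_
  rw [expectedPayoff_slopeDistribution hYc hYpos h0 (hA.1 hnull) hαs ha,
    ratio_of_mem_Ioo hαs, EReal.coe_le_coe_iff]
  exact div_le_div_of_nonneg_right (uLow_mono_set hYc ⟨_, hnull⟩ hA.1 αs)
    (neg_log_one_sub_pos hαs).le

/-- At slope `0` every costless action is optimal, and favourable tie-breaking may select `a`.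
Unfavourable tie-breaking could select another costless action, such as a null action. -/
lemma meanOutput_le_bestGuarantee_dirac (hYc : IsCompact Y) (hYpos : ∀ y ∈ Y, 0 ≤ y)
    {A₀ : Set (Action Y)} {a : Action Y} (ha : a ∈ A₀) (hac : a.2 = 0) :
    ((meanOutput a : ℝ) : EReal) ≤
      bestGuarantee A₀ (randomLinear Y ⟨Measure.dirac 0, inferInstance⟩) := by
  refine le_iInf₂ fun A hA => ?_
  have hwage : expectedWage (linearContract 0) a = 0 := by
    rw [expectedWage_linearContract hYc hYpos le_rfl, zero_mul, ENNReal.ofReal_zero]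
  have hopt : a ∈ optimalActions A (linearContract 0) := by
    refine ⟨hA.1 ha, fun b _ => ?_⟩
    rw [agentUtility_linearContract hYc hYpos le_rfl, agentUtility_linearContract hYc hYpos le_rfl,
      EReal.coe_le_coe_iff, hac]
    simp
  have hresp : (fun _ : ℝ => a) ∈
      responses A (randomLinear Y ⟨Measure.dirac 0, inferInstance⟩) := by
    change ∀ᵐ ω ∂(Measure.dirac (0 : ℝ)), a ∈ optimalActions A (linearContract ω)
    rw [ae_dirac_eq]
    exact hopt
  have e : expectedPayoff (randomLinear Y ⟨Measure.dirac 0, inferInstance⟩) (fun _ => a) =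
      ((∫⁻ _ : ℝ, ENNReal.ofReal (meanOutput a) ∂(Measure.dirac 0) : ℝ≥0∞) : EReal) -
        ((∫⁻ α : ℝ, expectedWage (linearContract α) a ∂(Measure.dirac 0) : ℝ≥0∞) : EReal) := rfl
  refine le_trans (le_of_eq ?_) (e.ge.trans (le_iSup₂ (f := fun b (_ : b ∈ responses A
    (randomLinear Y ⟨Measure.dirac 0, inferInstance⟩)) => expectedPayoff _ b) _ hresp))
  rw [lintegral_dirac, lintegral_dirac, hwage, EReal.coe_ennreal_ofReal,
    max_eq_left (meanOutput_nonneg hYpos a)]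
  simp

end LowerBound

end RobustContract

end

/-! ### The value of the contracting problem -/

open RobustContract
theorem theorem1 (Y : Set ℝ) (hYc : IsCompact Y) (hYpos : ∀ y ∈ Y, 0 ≤ y) (h0 : (0 : ℝ) ∈ Y)
    (A₀ : Set (Action Y)) (hfin : A₀.Finite) (hnull : nullAction h0 ∈ A₀)
    (hnontriv : ∃ a ∈ A₀, 0 < meanOutput a - (a.2 : ℝ)) :
    -- the ratio is well defined at `0`, and it has a maximizer on `[0, 1]`
    Tendsto (fun β => uLow A₀ β / (-Real.log (1 - β))) (𝓝[>] 0) (𝓝 (ratio A₀ 0)) ∧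
    (∃ αs ∈ Icc (0 : ℝ) 1, IsMaxOn (ratio A₀) (Icc 0 1) αs) ∧
    ∀ αs ∈ Icc (0 : ℝ) 1, IsMaxOn (ratio A₀) (Icc 0 1) αs →
      αs < 1 ∧ 0 < ratio A₀ αs ∧
      -- the linear contract with slope distribution `G*` attains the value
      (∃ G : ProbabilityMeasure ℝ,
        (∀ α : ℝ, ProbabilityTheory.cdf (G : Measure ℝ) α = gStar αs α) ∧
        bestGuarantee A₀ (randomLinear Y G) = ((ratio A₀ αs : ℝ) : EReal) ∧
        (0 < αs → worstGuarantee A₀ (randomLinear Y G) = ((ratio A₀ αs : ℝ) : EReal))) ∧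
      -- the value is optimal among all randomized contracts
      IsGreatest (range fun R : RandomContract Y => bestGuarantee A₀ R)
        ((ratio A₀ αs : ℝ) : EReal) ∧
      (0 < αs → IsGreatest (range fun R : RandomContract Y => worstGuarantee A₀ R)
        ((ratio A₀ αs : ℝ) : EReal)) ∧
      -- the degenerate case
      (αs = 0 → IsGreatest
        ((fun a : Action Y => (√(meanOutput a) - √(a.2 : ℝ)) ^ 2) ''
          {a | a ∈ A₀ ∧ (a.2 : ℝ) ≤ meanOutput a})
        (ratio A₀ αs)) ∧
      -- the explicit technology against which no contract does better
      A₀ ⊆ worstTechnology A₀ (ratio A₀ αs) ∧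
      (∀ w : Y → ℝ≥0, Continuous w →
        (optimalActions (worstTechnology A₀ (ratio A₀ αs)) w).Nonempty) ∧
      (∀ w : Y → ℝ≥0, Measurable w →
        ∀ a ∈ optimalActions (worstTechnology A₀ (ratio A₀ αs)) w,
          principalPayoff w a ≤ ((ratio A₀ αs : ℝ) : EReal)) ∧
      (∀ R : RandomContract Y,
        bestPayoff (worstTechnology A₀ (ratio A₀ αs)) R ≤ ((ratio A₀ αs : ℝ) : EReal)) ∧
      -- a part of it in which the agent has an optimal response to every randomized contract
      ∃ A : Set (Action Y), A₀ ⊆ A ∧ A ⊆ worstTechnology A₀ (ratio A₀ αs) ∧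
        ∀ R : RandomContract Y, (responses A R).Nonempty ∧
          bestPayoff A R ≤ ((ratio A₀ αs : ℝ) : EReal) := by
  obtain ⟨a₀, ha₀, hac₀, hle₀, hev⟩ :=
    exists_costless_eventually_uLow_eq hYc hYpos h0 hfin hnull
  have hr0 : ratio A₀ 0 = meanOutput a₀ := ratio_zero_eq hev
  have hlim : Tendsto (fun β => uLow A₀ β / (-Real.log (1 - β))) (𝓝[>] 0) (𝓝 (ratio A₀ 0)) := by
    rw [hr0]
    exact tendsto_quotient_zero hev
  refine ⟨hlim, isCompact_Icc.exists_isMaxOn ⟨0, by simp⟩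
    (continuousOn_ratio hYc ⟨_, hnull⟩ hlim), fun αs hαs hmax => ?_⟩
  have hV : 0 < ratio A₀ αs := ratio_pos_of_isMaxOn hYc hnontriv hmax
  have hlt : αs < 1 := by
    refine lt_of_le_of_ne hαs.2 fun h => ?_
    rw [h, ratio_one] at hV
    exact lt_irrefl _ hV
  have hle : ∀ α ∈ Ioo (0 : ℝ) 1, ratio A₀ α ≤ ratio A₀ αs := fun α hα =>
    isMaxOn_iff.1 hmax α (Ioo_subset_Icc_self hα)
  have hsub := subset_worstTechnology hYc hfin hV hle
  have hresp : ∀ R : RandomContract Y,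
      (responses (dilutedTechnology h0 A₀ (ratio A₀ αs)) R).Nonempty := fun R =>
    responses_nonempty (optimalActions_dilutedTechnology_nonempty hYc h0 hfin ⟨_, hnull⟩ hV hsub)
  have hdil : ∀ R : RandomContract Y,
      bestPayoff (dilutedTechnology h0 A₀ (ratio A₀ αs)) R ≤ ((ratio A₀ αs : ℝ) : EReal) :=
    bestPayoff_le hV (meanOutput_le_of_optimal_dilutedTechnology hYc hYpos h0 hV hsub)
  -- The diluted technology is used because it is admissible against every `R`, including
  -- discontinuous contracts.
  have hupper : ∀ R : RandomContract Y, bestGuarantee A₀ R ≤ ((ratio A₀ αs : ℝ) : EReal) :=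
    fun R => (iInf₂_le _ ⟨subset_union_left, hresp R⟩).trans (hdil R)
  have hworst := meanOutput_le_of_optimal_worstTechnology hYc hYpos h0 (A₀ := A₀) hV
  have hG : ∃ G : ProbabilityMeasure ℝ,
      (∀ α : ℝ, ProbabilityTheory.cdf (G : Measure ℝ) α = gStar αs α) ∧
      bestGuarantee A₀ (randomLinear Y G) = ((ratio A₀ αs : ℝ) : EReal) ∧
      (0 < αs → worstGuarantee A₀ (randomLinear Y G) = ((ratio A₀ αs : ℝ) : EReal)) := by
    rcases hαs.1.eq_or_lt with h | h
    · subst h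
      refine ⟨⟨Measure.dirac 0, inferInstance⟩, cdf_dirac_zero, (hupper _).antisymm ?_,
        fun h => absurd h (lt_irrefl _)⟩
      rw [hr0]
      exact meanOutput_le_bestGuarantee_dirac hYc hYpos ha₀ hac₀
    · have hlow := le_worstGuarantee_slopeDistribution hYc hYpos h0 hnull ⟨h, hlt⟩
      exact ⟨slopeDistribution ⟨h, hlt⟩, cdf_slopeDistribution ⟨h, hlt⟩,
        (hupper _).antisymm (hlow.trans (worstGuarantee_le_bestGuarantee _)),
        fun _ => ((worstGuarantee_le_bestGuarantee _).trans (hupper _)).antisymm hlow⟩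
  refine ⟨hlt, hV, hG, ?_, ?_, ?_, hsub, ?_, ?_, bestPayoff_le hV hworst,
    dilutedTechnology h0 A₀ (ratio A₀ αs), subset_union_left,
    dilutedTechnology_subset hYc hYpos h0 hV hsub, fun R => ⟨hresp R, hdil R⟩⟩
  · obtain ⟨G, -, hb, -⟩ := hG
    refine ⟨⟨_, hb⟩, ?_⟩
    rintro _ ⟨R, rfl⟩
    exact hupper R
  · intro h
    obtain ⟨G, -, -, hw⟩ := hG
    refine ⟨⟨_, hw h⟩, ?_⟩
    rintro _ ⟨R, rfl⟩
    exact (worstGuarantee_le_bestGuarantee R).trans (hupper R)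
  · intro h
    -- The maximum is reached at the best costless action, whose mean output is the ratio at `0`.
    refine ⟨⟨a₀, ⟨ha₀, ?_⟩, ?_⟩, ?_⟩
    · rw [hac₀]
      exact meanOutput_nonneg hYpos a₀
    · simp only [hac₀, NNReal.coe_zero, Real.sqrt_zero, sub_zero]
      rw [Real.sq_sqrt (meanOutput_nonneg hYpos a₀), h, hr0]
    · rintro _ ⟨a, ⟨ha, hac⟩, rfl⟩
      exact sq_sqrt_sub_sqrt_le hV a.2.2 hac (costFloor_le_cost hYc hV hle ha)
  · exact fun w hw => optimalActions_worstTechnology_nonempty hYc h0 hV hw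
  · exact fun w _ a ha => principalPayoff_le hYpos hV (hworst w a ha)
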